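/- For $w\in S_n$ use matrix coordinates on the $n\times n$ grid and place a dot $\bullet$ at each position $(i,w(i))$. The Rothe diagram is $D(w)=\{(i,j): j<w(i),\ i<w^{-1}(j)\}$; its elements are called boxes. The dominant component is the connected component of $D(w)$ (positions sharing an edge are adjacent) that contains $(1,1)$, if $(1,1)\in D(w)$. The essential set consists of the boxes $(i,j)\in D(w)$ with $(i+1,j),(i,j+1)\notin D(w)$. The accessible box is the southmost, then eastmost, essential box that is not in the dominant component. The pivots are the maximally southeast dots among the dots northwest of the accessible box. The permutation $w$ is vexillary if it avoids the pattern $2143$. The Lascoux–Schützenberger transition tree $\mathcal T(w)$ has root $w$. A node labelled by a vexillary permutation is a leaf. A node labelled by a non-vexillary $u$ with accessible box $(x,y)$ has one child $u'$ for each pivot $(c,d)$ of $u$: with $x'=u^{-1}(y)$ and $y'=u(x)$, $u'$ is obtained from $u$ by replacing the dots $(c,d),(x',y),(x,y')$ by $(c,y),(x,d),(x',y')$. Let $\mathcal L(w)$ be the multiset of leaf labels of $\mathcal T(w)$. The transition algorithm for $\#\mathsf{Red}(w)$ (the number of reduced words of $w$) traverses $\mathcal T(w)$, computes at each leaf $v$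 the number $f^{\lambda(v)}$ of standard Young tableaux of the shape $\lambda(v)$ (the partition shape obtained by pushing the boxes of $D(v)$ northwest along their diagonals) by the hook-length formula, and returns $\sum_{v\in\mathcal L(w)} f^{\lambda(v)}$. Its running time is the sum, over all nodes of $\mathcal T(w)$ (with multiplicity), of the number of steps spent at the node. **Theorem.** There is a constant $c>1$ such that, for $w$ uniformly distributed in $S_n$, $$\mathbb E[\#\mathcal L(w)]=\Omega(c^n)\qquad(n\to\infty).$$ That is, the average running time of transition, as an algorithm to compute $\#\mathsf{Red}(w)$, is at least exponential in $n$: if at each node at least one step is spent, then the expected running time on a uniform $w\in S_n$ is $\Omega(c^n)$, with the same $c$ and the same implied constant, whatever the numbers of steps spent at the individual nodes. -/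

import Mathlib

open scoped BigOperators

namespace LSTransition

open Equiv

/-- A permutation is vexillary if it avoids the pattern `2143`. -/
def IsVexillary {n : ℕ} (w : Perm (Fin n)) : Prop :=
  ¬ ∃ i₁ i₂ i₃ i₄ : Fin n, i₁ < i₂ ∧ i₂ < i₃ ∧ i₃ < i₄ ∧
    w i₂ < w i₁ ∧ w i₁ < w i₄ ∧ w i₄ < w i₃

/-- The Rothe diagram `D(w)`, in matrix coordinates (row, column); rows and columns are numbered
from `0`. Its elements are called boxes. -/
def rothe {n : ℕ} (w : Perm (Fin n)) : Finset (Fin n × Fin n) :=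
  Finset.univ.filter fun b => b.2 < w b.1 ∧ b.1 < w.symm b.2

/-- The dots of the graph `G(w)`: the positions `(i, w i)`. -/
def dots {n : ℕ} (w : Perm (Fin n)) : Finset (Fin n × Fin n) :=
  Finset.univ.filter fun b => w b.1 = b.2

/-- Two positions of the grid are adjacent if they share an edge. -/
def Adjacent {n : ℕ} (a b : Fin n × Fin n) : Prop :=
  (a.1 = b.1 ∧ (a.2.val + 1 = b.2.val ∨ b.2.val + 1 = a.2.val)) ∨
  (a.2 = b.2 ∧ (a.1.val + 1 = b.1.val ∨ b.1.val + 1 = a.1.val))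

/-- `b` lies in the dominant component, i.e. in the connected component of `D(w)` that contains
the northwest corner of the grid (if the corner is a box of `D(w)`). -/
def InDominant {n : ℕ} (w : Perm (Fin n)) (b : Fin n × Fin n) : Prop :=
  ∃ o ∈ rothe w, o.1.val = 0 ∧ o.2.val = 0 ∧
    Relation.ReflTransGen (fun a a' => a ∈ rothe w ∧ a' ∈ rothe w ∧ Adjacent a a') o b

/-- `b` belongs to the essential set: it is a box of `D(w)`, and neither the position just below
it nor the position just to its right is a box of `D(w)`. -/
def IsEssential {n : ℕ} (w : Perm (Fin n)) (b : Fin n × Fin n) : Prop :=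
  b ∈ rothe w ∧
  (∀ i : Fin n, i.val = b.1.val + 1 → (i, b.2) ∉ rothe w) ∧
  (∀ j : Fin n, j.val = b.2.val + 1 → (b.1, j) ∉ rothe w)

/-- `e` is the accessible box: the southmost, then eastmost, box of the essential set that is not
in the dominant component. -/
def IsAccessible {n : ℕ} (w : Perm (Fin n)) (e : Fin n × Fin n) : Prop :=
  IsEssential w e ∧ ¬ InDominant w e ∧
  ∀ b, IsEssential w b → ¬ InDominant w b → b.1 < e.1 ∨ (b.1 = e.1 ∧ b.2 ≤ e.2)

/-- `b` is a pivot with respect to the box `e`: a maximally southeast one among the dots of `G(w)`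
that are northwest of `e`. -/
def IsPivot {n : ℕ} (w : Perm (Fin n)) (e b : Fin n × Fin n) : Prop :=
  b ∈ dots w ∧ b.1 < e.1 ∧ b.2 < e.2 ∧
  ∀ b' ∈ dots w, b'.1 < e.1 → b'.2 < e.2 → b.1 ≤ b'.1 → b.2 ≤ b'.2 → b' = b

/-- The marching move at the box `e = (x, y)` and the dot `b = (c, d)`. Let `(x', y)` be the dot in
the column of `e` and `(x, y')` the dot in the row of `e`. The move leaves all other dots in place
and replaces `(c, d)`, `(x', y)`, `(x, y')` by `(x, d)`, `(c, y)`, `(x', y')`. In one-line notation,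
the permutation `w` becomes `w · (x x') · (c x)`. -/
def march {n : ℕ} (w : Perm (Fin n)) (e b : Fin n × Fin n) : Perm (Fin n) :=
  w * swap e.1 (w.symm e.2) * swap b.1 e.1

/-- `u` is a child of `w` in the transition tree: `w` is not vexillary, and `u` arises from `w` by
the marching move at the accessible box of `w` and one of the pivots of `w`. -/
def IsChild {n : ℕ} (w u : Perm (Fin n)) : Prop :=
  ¬ IsVexillary w ∧ ∃ e b, IsAccessible w e ∧ IsPivot w e b ∧ u = march w e b

open Classical in
/-- The children of `w` in the transition tree (the moves at distinct pivots have distinct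
results, because the pivot's row is the first one that changes). -/
noncomputable def children {n : ℕ} (w : Perm (Fin n)) : Finset (Perm (Fin n)) :=
  Finset.univ.filter fun u => IsChild w u

/-- A child is lexicographically larger than its parent; hence the transition tree is finite. -/
theorem lex_lt_of_mem_children {n : ℕ} {w u : Perm (Fin n)} (h : u ∈ children w) :
    toLex (w : Fin n → Fin n) < toLex (u : Fin n → Fin n) := by
  classical
  simp only [children, Finset.mem_filter, Finset.mem_univ, true_and] at h
  obtain ⟨-, e, b, he, ⟨hb, hb1, hb2, -⟩, rfl⟩ := h
  have hD : e.2 < w e.1 ∧ e.1 < w.symm e.2 := by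
    simpa [rothe] using he.1.1
  have hbd : w b.1 = b.2 := by simpa [dots] using hb
  refine ⟨b.1, fun j hj => ?_, ?_⟩
  · have h1 : j ≠ b.1 := hj.ne
    have h2 : j ≠ e.1 := (hj.trans hb1).ne
    have h3 : j ≠ w.symm e.2 := (hj.trans (hb1.trans hD.2)).ne
    simp [march, swap_apply_of_ne_of_ne, h1, h2, h3]
  · simp [march, hbd, hb2]

/-- The recursion along the transition tree is well-founded. -/
instance childRelation (n : ℕ) : WellFoundedRelation (Perm (Fin n)) where
  rel u w := u ∈ children w
  wf := Subrelation.wf (r := fun u w : Perm (Fin n) =>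
      toLex (w : Fin n → Fin n) < toLex (u : Fin n → Fin n))
    (fun h => lex_lt_of_mem_children h)
    (InvImage.wf (fun w : Perm (Fin n) => toLex (w : Fin n → Fin n))
      (wellFounded_gt (α := Lex (Fin n → Fin n))))

/-- The multiset `L(w)` of the labels of the leaves of the transition tree `T(w)`. The root of the
tree is `w`; a node labelled by a vexillary permutation is a leaf, and any other node `v` has one
child for each element of `children v`. -/
noncomputable def leaves {n : ℕ} (w : Perm (Fin n)) : Multiset (Perm (Fin n)) :=
  open Classical in
  if IsVexillary w then {w} else ∑ u : children w, leaves u.1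
termination_by w
decreasing_by exact u.2

/-- The shape `λ(w)`: push the boxes of `D(w)` northwest along their diagonals, as far as possible.
Afterwards the diagonal through `(i, j)` is occupied at its first `m` places, where `m` is the number
of boxes that `D(w)` has on this diagonal. -/
def shape {n : ℕ} (w : Perm (Fin n)) : Finset (Fin n × Fin n) :=
  Finset.univ.filter fun b => min b.1.val b.2.val <
    ((rothe w).filter fun a => a.1.val + b.2.val = b.1.val + a.2.val).card

/-- The hook length of the position `b` in the shape `s`: the number of boxes of `s` that are in the
row of `b`, weakly right of it, or in the column of `b`, strictly below it. -/
def hookLength {n : ℕ} (s : Finset (Fin n × Fin n)) (b : Fin n × Fin n) : ℕ :=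
  (s.filter fun a => (a.1 = b.1 ∧ b.2 ≤ a.2) ∨ (a.2 = b.2 ∧ b.1 < a.1)).card

/-- The number `f^λ` of standard Young tableaux of shape `s`, by the hook-length formula. -/
def hookFormula {n : ℕ} (s : Finset (Fin n × Fin n)) : ℕ :=
  s.card.factorial / ∏ b ∈ s, hookLength s b

/-- The transition algorithm, run on `w`, as a recursive procedure with a step count. It walks
through the transition tree. At a vexillary node `v` it returns `f^{λ(v)}`; at any other node it
calls itself on each of the children and returns the sum of the results. Its own work at a node
labelled `v` (vexillarity test, hook-length formula, computation of the children, addition) takes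
`cost v` steps. The first component of the result is the returned number, the second component is
the total number of steps. -/
noncomputable def run {n : ℕ} (cost : Perm (Fin n) → ℕ) (w : Perm (Fin n)) : ℕ × ℕ :=
  open Classical in
  if IsVexillary w then (hookFormula (shape w), cost w)
  else (0, cost w) + ∑ u : children w, run cost u.1
termination_by w
decreasing_by exact u.2

/-- The running time of the transition algorithm on the input `w`, where `cost v` is the number of
steps that are spent at a node labelled `v`. -/
noncomputable def runningTime {n : ℕ} (cost : Perm (Fin n) → ℕ) (w : Perm (Fin n)) : ℕ :=
  (run cost w).2

/-- The expectation of `X w` for `w` uniformly distributed in the symmetric group `S_n`. -/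
noncomputable def expectation (n : ℕ) (X : Perm (Fin n) → ℝ) : ℝ :=
  𝔼 w : Perm (Fin n), X w

end LSTransition

open scoped BigOperators

namespace LSTransition

open Equiv

/-! ### Boxes, pivots and the transition tree. -/

section Tree

variable {n : ℕ} {w : Perm (Fin n)}

/-! A typical permutation contains linearly many disjoint pieces of `2143` patterns, and the tree
cannot use them up without branching. Call three consecutive rows a block if their values form the
`214` of a `2143`, with the "1" and "2" below `l` and the "4" at least `h`. Any later value in `[l,
h)` then completes the pattern, so such values form a common supply for all blocks.

The invariant (`two_pow_le_card_leaves`) is that `2k` blocks and `k` supply values after them force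
`2 ^ k` leaves. If a node has a unique pivot, that pivot is southeast of every dot northwest of the
accessible box, and the move then preserves all blocks and the whole supply. If there are at least
two pivots, each child loses at most two blocks (those meeting the pivot row and the box row) and
one supply value (the column of the box), while the bound only has to halve.

For uniform `w` the expected number of blocks is linear in `n` (`mul_factorial_le_sum_card_blocks`),
and convexity of the exponential turns this into an exponential lower bound for the mean
(`exp_le_expectation_exp`). -/

theorem mem_rothe {b : Fin n × Fin n} : b ∈ rothe w ↔ b.2 < w b.1 ∧ b.1 < w.symm b.2 := by
  simp [rothe]

theorem mem_dots {b : Fin n × Fin n} : b ∈ dots w ↔ w b.1 = b.2 := by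
  simp [dots]

/-- There is no dot weakly northwest of a box of the dominant component. -/
theorem InDominant.lt_apply {b : Fin n × Fin n} (h : InDominant w b) :
    ∀ i ≤ b.1, b.2 < w i := by
  obtain ⟨o, ho, h1, h2, hp⟩ := h
  induction hp with
  | refl =>
    intro i hi
    have : i = o.1 := Fin.ext (by have := Fin.le_def.1 hi; omega)
    subst this
    exact (mem_rothe.1 ho).1
  | @tail a a' _ hs ih =>
    obtain ⟨-, ha', hadj⟩ := hs
    rw [mem_rothe] at ha'
    intro i hi
    rcases hadj with ⟨h, h'⟩ | ⟨h, h'⟩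
    · have hlt := ih i (h ▸ hi)
      -- A step east could only fail at a dot in the new column, but the dot of that column lies
      -- strictly below the box `a'`.
      have hne : w i ≠ a'.2 := fun he => by
        have : w.symm a'.2 = i := by rw [← he, symm_apply_apply]
        exact absurd (this ▸ ha'.2) (not_lt.2 hi)
      have hne' : (w i).val ≠ a'.2.val := fun he => hne (Fin.ext he)
      simp only [Fin.lt_def] at hlt ⊢
      omega
    · rw [← h]
      rcases h' with h' | h'
      · by_cases hia : i ≤ a.1
        · exact ih i hia
        · have : i = a'.1 := Fin.ext (by simp only [Fin.le_def] at hi hia; omega)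
          rw [this, h]
          exact ha'.1
      · exact ih i (by simp only [Fin.le_def] at hi ⊢; omega)

/-- A box without dots northwest of it lies in the dominant component. -/
theorem inDominant_of_lt_apply {b : Fin n × Fin n} (h : ∀ i ≤ b.1, b.2 < w i) :
    InDominant w b := by
  have hmem : ∀ a : Fin n × Fin n, a.1 ≤ b.1 → a.2 ≤ b.2 → a ∈ rothe w := by
    intro a h1 h2
    refine mem_rothe.2 ⟨h2.trans_lt (h _ h1), ?_⟩
    by_contra hc
    have := h _ ((not_lt.1 hc).trans h1)
    rw [apply_symm_apply] at this
    exact absurd this (not_lt.2 h2)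
  have hn : 0 < n := b.1.pos
  refine ⟨(⟨0, hn⟩, ⟨0, hn⟩), hmem _ (Fin.le_def.2 (Nat.zero_le _)) (Fin.le_def.2 (Nat.zero_le _)),
    rfl, rfl, ?_⟩
  -- The whole rectangle northwest of `b` consists of boxes; the path runs along the top row and
  -- then down a column.
  suffices H : ∀ m : ℕ, ∀ a : Fin n × Fin n, a.1.val + a.2.val = m → a.1 ≤ b.1 → a.2 ≤ b.2 →
      Relation.ReflTransGen (fun a a' => a ∈ rothe w ∧ a' ∈ rothe w ∧ Adjacent a a')
        ((⟨0, hn⟩, ⟨0, hn⟩) : Fin n × Fin n) a from H _ b rfl le_rfl le_rfl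
  intro m
  induction m with
  | zero =>
    rintro ⟨i, j⟩ hm - -
    have hi : i = ⟨0, hn⟩ := Fin.ext (by simp only at hm ⊢; omega)
    have hj : j = ⟨0, hn⟩ := Fin.ext (by simp only at hm ⊢; omega)
    rw [hi, hj]
  | succ m ih =>
    rintro ⟨i, j⟩ hm h1 h2
    simp only at hm h1 h2
    by_cases hi : i.val = 0
    · have hlt : j.val - 1 < n := by omega
      have h2' : (⟨j.val - 1, hlt⟩ : Fin n) ≤ b.2 := by
        simp only [Fin.le_def] at h2 ⊢; omega
      refine (ih (i, ⟨j.val - 1, hlt⟩) (by simp only; omega) h1 h2').tail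
        ⟨hmem _ h1 h2', hmem _ h1 h2, Or.inl ⟨rfl, Or.inl ?_⟩⟩
      simp only; omega
    · have hlt : i.val - 1 < n := by omega
      have h1' : (⟨i.val - 1, hlt⟩ : Fin n) ≤ b.1 := by
        simp only [Fin.le_def] at h1 ⊢; omega
      refine (ih (⟨i.val - 1, hlt⟩, j) (by simp only; omega) h1' h2).tail
        ⟨hmem _ h1' h2, hmem _ h1 h2, Or.inr ⟨rfl, Or.inl ?_⟩⟩
      simp only; omega

/-- Southeast of any box there is an essential box. -/
theorem exists_isEssential_ge {b : Fin n × Fin n} (hb : b ∈ rothe w) :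
    ∃ e, IsEssential w e ∧ b ≤ e := by
  obtain ⟨e, hbe, he⟩ := (rothe w).exists_le_maximal hb
  refine ⟨e, ⟨he.1, fun i hi hmem => ?_, fun j hj hmem => ?_⟩, hbe⟩
  · have hle : e ≤ (i, e.2) := ⟨Fin.le_def.2 (by simp only; omega), le_rfl⟩
    have := (he.2 hmem hle).1
    simp only [Fin.le_def] at this
    omega
  · have hle : e ≤ (e.1, j) := ⟨le_rfl, Fin.le_def.2 (by simp only; omega)⟩
    have := (he.2 hmem hle).2
    simp only [Fin.le_def] at this
    omega

theorem exists_isEssential_not_inDominant {b : Fin n × Fin n} (hb : b ∈ rothe w) {i : Fin n}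
    (hi : i ≤ b.1) (hwi : w i ≤ b.2) : ∃ e, IsEssential w e ∧ ¬ InDominant w e ∧ b ≤ e := by
  obtain ⟨e, he, hbe⟩ := exists_isEssential_ge hb
  exact ⟨e, he, fun hd => absurd (hd.lt_apply i (hi.trans hbe.1)) (not_lt.2 (hwi.trans hbe.2)),
    hbe⟩

/-- The accessible box is weakly below every box that has a dot northwest of it. -/
theorem IsAccessible.le_of_mem_rothe {e b : Fin n × Fin n} (he : IsAccessible w e)
    (hb : b ∈ rothe w) {i : Fin n} (hi : i ≤ b.1) (hwi : w i ≤ b.2) :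
    b.1 < e.1 ∨ (b.1 = e.1 ∧ b.2 ≤ e.2) := by
  obtain ⟨e', he', hd, hbe⟩ := exists_isEssential_not_inDominant hb hi hwi
  rcases he.2.2 e' he' hd with h | ⟨h, h'⟩
  · exact Or.inl (hbe.1.trans_lt h)
  · rcases hbe.1.lt_or_eq with h1 | h1
    · exact Or.inl (h ▸ h1)
    · exact Or.inr ⟨h1.trans h, hbe.2.trans h'⟩

theorem exists_isAccessible {b : Fin n × Fin n} (hb : b ∈ rothe w) {i : Fin n}
    (hi : i ≤ b.1) (hwi : w i ≤ b.2) : ∃ e, IsAccessible w e := by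
  classical
  obtain ⟨e', he', hd, -⟩ := exists_isEssential_not_inDominant hb hi hwi
  obtain ⟨e, he, hmax⟩ := (Finset.univ.filter fun a => IsEssential w a ∧ ¬ InDominant w a)
    |>.exists_max_image (fun a => toLex a) ⟨e', by simp [he', hd]⟩
  simp only [Finset.mem_filter, Finset.mem_univ, true_and] at he hmax
  refine ⟨e, he.1, he.2, fun a ha hda => ?_⟩
  have := hmax a ⟨ha, hda⟩
  rwa [Prod.Lex.toLex_le_toLex] at this

/-- Southeast of any dot northwest of `e` there is a pivot. -/
theorem exists_isPivot_ge {e : Fin n × Fin n} {i : Fin n} (hi : i < e.1) (hwi : w i < e.2) :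
    ∃ b, IsPivot w e b ∧ i ≤ b.1 ∧ w i ≤ b.2 := by
  obtain ⟨b, hb, hmax⟩ := ((dots w).filter fun a => a.1 < e.1 ∧ a.2 < e.2).exists_le_maximal
    (a := (i, w i)) (by simp [mem_dots, hi, hwi])
  have hmem := hmax.1
  simp only [Finset.mem_filter] at hmem
  refine ⟨b, ⟨hmem.1, hmem.2.1, hmem.2.2, fun b' hb' h1 h2 h3 h4 => ?_⟩, hb.1, hb.2⟩
  exact le_antisymm (hmax.2 (y := b') (by simp [hb', h1, h2]) ⟨h3, h4⟩) ⟨h3, h4⟩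

/-- With no dot northwest of it, the accessible box would lie in the dominant component. -/
theorem IsAccessible.exists_isPivot {e : Fin n × Fin n} (he : IsAccessible w e) :
    ∃ b, IsPivot w e b := by
  by_contra hc
  refine he.2.1 (inDominant_of_lt_apply fun i hi => ?_)
  have hD := mem_rothe.1 he.1.1
  rcases hi.lt_or_eq with h | rfl
  · by_contra hlt
    rcases (not_lt.1 hlt).lt_or_eq with h' | h'
    · obtain ⟨b, hb, -⟩ := exists_isPivot_ge h h'
      exact hc ⟨b, hb⟩
    · rw [← h', symm_apply_apply] at hD
      exact absurd hD.2 (not_lt.2 hi)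
  · exact hD.1

/-! ### Effect of a marching move on the dots. -/

section March

variable {e b : Fin n × Fin n}

theorem march_apply_pivot_row :
    march w e b b.1 = e.2 := by
  simp [march]

theorem march_apply_box_row (hD : e ∈ rothe w) (hb : IsPivot w e b) :
    march w e b e.1 = w b.1 := by
  have h1 : b.1 ≠ w.symm e.2 := (hb.2.1.trans (mem_rothe.1 hD).2).ne
  simp [march, swap_apply_of_ne_of_ne hb.2.1.ne h1]

theorem march_apply_symm (hD : e ∈ rothe w) (hb : IsPivot w e b) :
    march w e b (w.symm e.2) = w e.1 := by
  have h1 : w.symm e.2 ≠ b.1 := (hb.2.1.trans (mem_rothe.1 hD).2).ne'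
  simp [march, swap_apply_of_ne_of_ne h1 (mem_rothe.1 hD).2.ne']

theorem march_apply_of_ne {i : Fin n} (h1 : i ≠ b.1) (h2 : i ≠ e.1) (h3 : i ≠ w.symm e.2) :
    march w e b i = w i := by
  simp [march, swap_apply_of_ne_of_ne h1 h2, swap_apply_of_ne_of_ne h2 h3]

/-- A marching move moves every dot weakly south, keeping its column, except for the dot in the
column of the box. -/
theorem symm_le_march_symm (hD : e ∈ rothe w) (hb : IsPivot w e b) {v : Fin n} (hv : v ≠ e.2) :
    w.symm v ≤ (march w e b).symm v := by
  obtain ⟨i, rfl⟩ := w.surjective v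
  rw [symm_apply_apply]
  by_cases h1 : i = b.1
  · subst h1
    rw [← march_apply_box_row hD hb, symm_apply_apply]
    exact hb.2.1.le
  by_cases h2 : i = e.1
  · subst h2
    rw [← march_apply_symm hD hb, symm_apply_apply]
    exact (mem_rothe.1 hD).2.le
  have h3 : i ≠ w.symm e.2 := fun h => hv (by rw [h, apply_symm_apply])
  conv_rhs => rw [← march_apply_of_ne (b := b) h1 h2 h3, symm_apply_apply]

theorem march_symm_box_col :
    (march w e b).symm e.2 = b.1 := by
  rw [symm_apply_eq, march_apply_pivot_row]

/-- The pivot row can be read off from the result: it is the new row of the dot in the column of the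
box. -/
theorem march_injOn {b' : Fin n × Fin n} (hb : IsPivot w e b)
    (hb' : IsPivot w e b') (h : march w e b = march w e b') : b = b' := by
  have h1 : b.1 = b'.1 := by
    rw [← march_symm_box_col (w := w) (e := e) (b := b),
      ← march_symm_box_col (w := w) (e := e) (b := b'), h]
  exact Prod.ext h1 (by rw [← mem_dots.1 hb.1, ← mem_dots.1 hb'.1, h1])

end March

/-! ### Recursions for the leaf count and the running time. -/

theorem mem_children {u : Perm (Fin n)} : u ∈ children w ↔ IsChild w u := by
  simp [children]

theorem exists_isAccessible_of_not_isVexillary (h : ¬ IsVexillary w) :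
    ∃ e, IsAccessible w e := by
  obtain ⟨i₁, i₂, i₃, i₄, h12, h23, h34, h21, h14, h43⟩ := not_not.1 h
  refine exists_isAccessible (b := (i₃, w i₄)) (i := i₁) ?_ (h12.trans h23).le h14.le
  rw [mem_rothe]
  simpa using ⟨h43, h34⟩

theorem card_leaves_of_isVexillary (h : IsVexillary w) : (leaves w).card = 1 := by
  rw [leaves]
  simp [h]

theorem card_leaves_of_not_isVexillary (h : ¬ IsVexillary w) :
    (leaves w).card = ∑ u ∈ children w, (leaves u).card := by
  rw [leaves, if_neg h, Multiset.card_sum]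
  exact Finset.sum_coe_sort (children w) fun u => (leaves u).card

theorem runningTime_of_isVexillary (cost : Perm (Fin n) → ℕ) (h : IsVexillary w) :
    runningTime cost w = cost w := by
  rw [runningTime, run]
  simp [h]

theorem runningTime_of_not_isVexillary (cost : Perm (Fin n) → ℕ) (h : ¬ IsVexillary w) :
    runningTime cost w = cost w + ∑ u ∈ children w, runningTime cost u := by
  rw [runningTime, run, if_neg h, Prod.snd_add, Prod.snd_sum]
  congr 1
  exact Finset.sum_coe_sort (children w) fun u => runningTime cost u

/-- If every node costs at least one step, then the running time is at least the number of
leaves. -/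
theorem card_leaves_le_runningTime {cost : Perm (Fin n) → ℕ} (hc : ∀ v, 1 ≤ cost v)
    (w : Perm (Fin n)) : (leaves w).card ≤ runningTime cost w := by
  induction w using (childRelation n).wf.induction with
  | _ w ih =>
    by_cases h : IsVexillary w
    · rw [card_leaves_of_isVexillary h, runningTime_of_isVexillary cost h]
      exact hc w
    · rw [card_leaves_of_not_isVexillary h, runningTime_of_not_isVexillary cost h]
      exact (Finset.sum_le_sum fun u hu => ih u hu).trans (Nat.le_add_left _ _)

theorem one_le_card_leaves (w : Perm (Fin n)) : 1 ≤ (leaves w).card := by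
  induction w using (childRelation n).wf.induction with
  | _ w ih =>
    by_cases h : IsVexillary w
    · rw [card_leaves_of_isVexillary h]
    · rw [card_leaves_of_not_isVexillary h]
      obtain ⟨e, he⟩ := exists_isAccessible_of_not_isVexillary h
      obtain ⟨b, hb⟩ := he.exists_isPivot
      have hu : march w e b ∈ children w := mem_children.2 ⟨h, e, b, he, hb, rfl⟩
      exact (ih _ hu).trans (Finset.single_le_sum (f := fun u => (leaves u).card)
        (fun _ _ => Nat.zero_le _) hu)

end Tree

/-! ### Blocks and supply along the tree. -/

section Invariant

variable {n : ℕ} {w : Perm (Fin n)} {l h : ℕ} {T : Finset ℕ}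

/-- The rows `3t`, `3t+1`, `3t+2` of `w` are the first three rows of a pattern `2143` whose last
entry may be any later value in the interval `[l, h)`. -/
def IsBlock (w : Perm (Fin n)) (l h t : ℕ) : Prop :=
  ∃ i j k : Fin n, i.val = 3 * t ∧ j.val = 3 * t + 1 ∧ k.val = 3 * t + 2 ∧
    w j < w i ∧ (w i).val < l ∧ h ≤ (w k).val

/-- The values in `[l, h)` that occur in `w` after all the blocks with index in `T`. -/
def supply (w : Perm (Fin n)) (l h : ℕ) (T : Finset ℕ) : Finset (Fin n) :=
  Finset.univ.filter fun v => l ≤ v.val ∧ v.val < h ∧ ∀ t ∈ T, 3 * t + 2 < (w.symm v).val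

theorem mem_supply {v : Fin n} : v ∈ supply w l h T ↔
    l ≤ v.val ∧ v.val < h ∧ ∀ t ∈ T, 3 * t + 2 < (w.symm v).val := by
  simp [supply]

theorem supply_anti {T' : Finset ℕ} (hT : T' ⊆ T) : supply w l h T ⊆ supply w l h T' :=
  fun _ hv => mem_supply.2 ⟨(mem_supply.1 hv).1, (mem_supply.1 hv).2.1,
    fun t ht => (mem_supply.1 hv).2.2 t (hT ht)⟩

theorem IsBlock.exists_mem_rothe {t : ℕ} (hB : IsBlock w l h t) {v : Fin n} (hv : l ≤ v.val)
    (hv' : v.val < h) (ht : 3 * t + 2 < (w.symm v).val) :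
    ∃ i k : Fin n, k.val = 3 * t + 2 ∧ (k, v) ∈ rothe w ∧ i < k ∧ w i < v := by
  obtain ⟨i, j, k, hi, hj, hk, h1, h2, h3⟩ := hB
  refine ⟨i, k, hk, mem_rothe.2 ⟨?_, ?_⟩, ?_, ?_⟩ <;> simp only [Fin.lt_def] <;> omega

theorem IsBlock.not_isVexillary {t : ℕ} (hB : IsBlock w l h t) {v : Fin n} (hv : l ≤ v.val)
    (hv' : v.val < h) (ht : 3 * t + 2 < (w.symm v).val) : ¬ IsVexillary w := by
  obtain ⟨i, j, k, hi, hj, hk, h1, h2, h3⟩ := hB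
  refine not_not.2 ⟨i, j, k, w.symm v, ?_⟩
  simp only [apply_symm_apply, Fin.lt_def] at h1 ⊢
  omega

section

variable {e b : Fin n × Fin n}

/-- The row of the "4" and the column of the supply value meet in a box with the dot "2" northwest
of it, which keeps the accessible box from lying higher up. -/
theorem IsAccessible.le_of_isBlock (he : IsAccessible w e) {t : ℕ} (hB : IsBlock w l h t)
    {v : Fin n} (hv : l ≤ v.val) (hv' : v.val < h) (ht : 3 * t + 2 < (w.symm v).val) :
    3 * t + 2 < e.1.val ∨ (3 * t + 2 = e.1.val ∧ l ≤ e.2.val) := by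
  obtain ⟨i, k, hk, hD, hik, hwi⟩ := hB.exists_mem_rothe hv hv' ht
  have := he.le_of_mem_rothe hD hik.le hwi.le
  simp only [Fin.lt_def, Fin.le_def, Fin.ext_iff] at this
  omega

/-- Besides the pivot row, only the row of the box and a row below it change. -/
theorem IsBlock.march_of_ne {t : ℕ} (hB : IsBlock w l h t) (hD : e ∈ rothe w)
    (ht : 3 * t + 2 < e.1.val) (hc : b.1.val / 3 ≠ t) : IsBlock (march w e b) l h t := by
  obtain ⟨i, j, k, hi, hj, hk, h1, h2, h3⟩ := hB
  have hx := Fin.lt_def.1 (mem_rothe.1 hD).2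
  have key : ∀ a : Fin n, 3 * t ≤ a.val → a.val ≤ 3 * t + 2 → march w e b a = w a := by
    intro a ha ha'
    apply march_apply_of_ne <;> intro heq <;> subst heq <;> omega
  refine ⟨i, j, k, hi, hj, hk, ?_⟩
  rw [key i (by omega) (by omega), key j (by omega) (by omega), key k (by omega) (by omega)]
  exact ⟨h1, h2, h3⟩

/-- If there is a unique pivot, it is southeast of all the dots northwest of the box. -/
theorem le_of_unique_pivot (hu : ∀ b', IsPivot w e b' → b' = b) {i : Fin n} (hi : i < e.1)
    (hwi : w i < e.2) : i ≤ b.1 ∧ w i ≤ b.2 := by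
  obtain ⟨b', hb', h1⟩ := exists_isPivot_ge hi hwi
  rwa [hu b' hb'] at h1

/-- The pivot is weakly southeast of both dots of the descent, and the lower dot is too far west to
be the pivot itself. -/
theorem lt_of_unique_pivot (hb : IsPivot w e b) (hu : ∀ b', IsPivot w e b' → b' = b)
    {i j : Fin n} (hij : i < j) (hw : w j < w i) (hj : j < e.1) (hwi : w i < e.2) : j < b.1 := by
  have h1 := le_of_unique_pivot hu hj (hw.trans hwi)
  have h2 := le_of_unique_pivot hu (hij.trans hj) hwi
  refine h1.1.lt_of_ne fun heq => ?_
  have := mem_dots.1 hb.1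
  rw [← heq] at this
  exact absurd (this ▸ h2.2) (not_le.2 hw)

/-- Otherwise the "21" of the block would be northwest of the box, and the unique pivot would need a
row strictly between two consecutive rows. -/
theorem IsBlock.ne_of_unique_pivot {t : ℕ} (hB : IsBlock w l h t) (hb : IsPivot w e b)
    (hu : ∀ b', IsPivot w e b' → b' = b) (he : l ≤ e.2.val) : 3 * t + 2 ≠ e.1.val := by
  obtain ⟨i, j, k, hi, hj, hk, h1, h2, h3⟩ := hB
  intro hx
  have := lt_of_unique_pivot hb hu (i := i) (j := j) (Fin.lt_def.2 (by omega)) h1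
    (Fin.lt_def.2 (by omega)) (Fin.lt_def.2 (by omega))
  have h4 := hb.2.1
  simp only [Fin.lt_def] at this h4
  omega

/-- Only a pivot inside the block matters; its value rises to the column `y` of the box. If `y`
exceeds the "2", the pivot is below the "1", so it is the "4", which may grow. If `y` is smaller
than the "2", the pivot must be the "1", and its new value `y` is still smaller than the "2". -/
theorem IsBlock.march_of_unique_pivot {t : ℕ} (hB : IsBlock w l h t) (hD : e ∈ rothe w)
    (hb : IsPivot w e b) (hu : ∀ b', IsPivot w e b' → b' = b) (hlh : l ≤ h)
    (ht : 3 * t + 2 < e.1.val) : IsBlock (march w e b) l h t := by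
  by_cases hc : b.1.val / 3 ≠ t
  · exact hB.march_of_ne hD ht hc
  obtain ⟨i, j, k, hi, hj, hk, h1, h2, h3⟩ := hB
  have hx := Fin.lt_def.1 (mem_rothe.1 hD).2
  have hwb := mem_dots.1 hb.1
  have hd := Fin.lt_def.1 hb.2.2.1
  have key : ∀ a : Fin n, a ≠ b.1 → a.val ≤ 3 * t + 2 → march w e b a = w a := by
    intro a ha ha'
    refine march_apply_of_ne ha ?_ ?_ <;> intro heq <;> subst heq <;> omega
  by_cases hy : w i < e.2
  · have hjb := Fin.lt_def.1 (lt_of_unique_pivot hb hu (i := i) (j := j)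
      (Fin.lt_def.2 (by omega)) h1 (Fin.lt_def.2 (by omega)) hy)
    have hkb : k = b.1 := Fin.ext (by omega)
    refine ⟨i, j, k, hi, hj, hk, ?_⟩
    rw [key i (fun hh => by rw [hh] at hi; omega) (by omega),
      key j (fun hh => by rw [hh] at hj; omega) (by omega), hkb, march_apply_pivot_row]
    rw [hkb, hwb] at h3
    exact ⟨h1, h2, by omega⟩
  · have hne : w i ≠ e.2 := fun hh => by
      rw [← hh, symm_apply_apply] at hx
      omega
    have hlt : e.2 < w i := lt_of_le_of_ne (not_lt.1 hy) hne.symm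
    have hlt' := Fin.lt_def.1 hlt
    have hib : i ≠ b.1 := fun hh => by rw [hh, hwb] at hlt'; omega
    have hkb : k ≠ b.1 := fun hh => by rw [hh, hwb] at h3; omega
    have hjb : j = b.1 := Fin.ext (by
      have h4 : i.val ≠ b.1.val := fun hh => hib (Fin.ext hh)
      have h5 : k.val ≠ b.1.val := fun hh => hkb (Fin.ext hh)
      omega)
    refine ⟨i, j, k, hi, hj, hk, ?_⟩
    rw [key i hib (by omega), key k hkb (by omega), hjb, march_apply_pivot_row]
    exact ⟨hlt, h2, h3⟩

theorem supply_erase_subset_supply_march (hD : e ∈ rothe w) (hb : IsPivot w e b) :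
    (supply w l h T).erase e.2 ⊆ supply (march w e b) l h T := by
  intro v hv
  rw [Finset.mem_erase, mem_supply] at hv
  exact mem_supply.2 ⟨hv.2.1, hv.2.2.1, fun t ht => (hv.2.2.2 t ht).trans_le
    (Fin.le_def.1 (symm_le_march_symm hD hb hv.1))⟩

/-- Only the value `e.2` moves north, to the pivot row. That row is below the "21" of each block,
and it is not the row of the "4", whose value is at least `h`. -/
theorem supply_subset_supply_march_of_unique_pivot (hD : e ∈ rothe w) (hb : IsPivot w e b)
    (hu : ∀ b', IsPivot w e b' → b' = b) (hT : ∀ t ∈ T, IsBlock w l h t)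
    (hx : ∀ t ∈ T, 3 * t + 2 < e.1.val) : supply w l h T ⊆ supply (march w e b) l h T := by
  intro v hv
  by_cases hve : v = e.2
  · subst hve
    rw [mem_supply] at hv ⊢
    refine ⟨hv.1, hv.2.1, fun t ht => ?_⟩
    rw [march_symm_box_col]
    obtain ⟨i, j, k, hi, hj, hk, h1, h2, h3⟩ := hT t ht
    have hxt := hx t ht
    have hjb := Fin.lt_def.1 (lt_of_unique_pivot hb hu (i := i) (j := j)
      (Fin.lt_def.2 (by omega)) h1 (Fin.lt_def.2 (by omega)) (Fin.lt_def.2 (by omega)))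
    have hkb : k.val ≠ b.1.val := fun hh => by
      have hd := Fin.lt_def.1 hb.2.2.1
      rw [Fin.ext hh, mem_dots.1 hb.1] at h3
      omega
    omega
  · exact supply_erase_subset_supply_march hD hb (Finset.mem_erase.2 ⟨hve, hv⟩)

end

/-- If `w` has `2k` blocks, followed by `k` values in `[l, h)`, then its transition tree has at least
`2 ^ k` leaves. -/
theorem two_pow_le_card_leaves (hlh : l ≤ h) (w : Perm (Fin n)) : ∀ (k : ℕ) (T : Finset ℕ),
    (∀ t ∈ T, IsBlock w l h t) → 2 * k ≤ T.card → k ≤ (supply w l h T).card →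
    2 ^ k ≤ (leaves w).card := by
  induction w using (childRelation n).wf.induction with
  | _ w ih =>
  intro k T hT hk hs
  obtain _ | k := k
  · simpa using one_le_card_leaves w
  obtain ⟨v, hv⟩ : (supply w l h T).Nonempty := Finset.card_pos.1 (by omega)
  obtain ⟨t₀, ht₀⟩ : T.Nonempty := Finset.card_pos.1 (by omega)
  rw [mem_supply] at hv
  have hvex : ¬ IsVexillary w := (hT t₀ ht₀).not_isVexillary hv.1 hv.2.1 (hv.2.2 t₀ ht₀)
  rw [card_leaves_of_not_isVexillary hvex]
  obtain ⟨e, he⟩ := exists_isAccessible_of_not_isVexillary hvex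
  have hD := he.1.1
  have hx : ∀ t ∈ T, 3 * t + 2 < e.1.val ∨ (3 * t + 2 = e.1.val ∧ l ≤ e.2.val) :=
    fun t ht => he.le_of_isBlock (hT t ht) hv.1 hv.2.1 (hv.2.2 t ht)
  obtain ⟨b, hb⟩ := he.exists_isPivot
  have hch : ∀ b', IsPivot w e b' → march w e b' ∈ children w :=
    fun b' hb' => mem_children.2 ⟨hvex, e, b', he, hb', rfl⟩
  by_cases hu : ∀ b', IsPivot w e b' → b' = b
  · have hx' : ∀ t ∈ T, 3 * t + 2 < e.1.val := fun t ht =>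
      (hx t ht).resolve_right fun hh => (hT t ht).ne_of_unique_pivot hb hu hh.2 hh.1
    refine (ih _ (hch b hb) (k + 1) T
      (fun t ht => (hT t ht).march_of_unique_pivot hD hb hu hlh (hx' t ht)) hk
      (hs.trans (Finset.card_le_card
        (supply_subset_supply_march_of_unique_pivot hD hb hu hT hx')))).trans
      (Finset.single_le_sum (f := fun u => (leaves u).card) (fun _ _ => Nat.zero_le _) (hch b hb))
  · have main : ∀ b', IsPivot w e b' → 2 ^ k ≤ (leaves (march w e b')).card := by
      intro b' hb'
      -- Division by 3 gives the index of the block that could contain a row.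
      refine ih _ (hch b' hb') k ((T.erase (b'.1.val / 3)).erase (e.1.val / 3)) ?_ ?_ ?_
      · intro t ht
        simp only [Finset.mem_erase] at ht
        refine (hT t ht.2.2).march_of_ne hD ?_ (Ne.symm ht.2.1)
        rcases hx t ht.2.2 with hh | hh <;> omega
      · have h1 := Finset.pred_card_le_card_erase (s := T) (a := b'.1.val / 3)
        have h2 := Finset.pred_card_le_card_erase (s := T.erase (b'.1.val / 3))
          (a := e.1.val / 3)
        omega
      · have h1 := Finset.pred_card_le_card_erase (s := supply w l h T) (a := e.2)
        have h2 := Finset.card_le_card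
          (supply_erase_subset_supply_march (l := l) (h := h) (T := T) hD hb')
        have h3 := Finset.card_le_card (supply_anti (w := march w e b') (l := l) (h := h)
          ((Finset.erase_subset (e.1.val / 3) _).trans (Finset.erase_subset (b'.1.val / 3) T)))
        omega
    push Not at hu
    obtain ⟨b', hb', hne⟩ := hu
    have hne' : march w e b' ≠ march w e b := fun hh => hne (march_injOn hb' hb hh)
    calc 2 ^ (k + 1) = 2 ^ k + 2 ^ k := by ring
      _ ≤ (leaves (march w e b')).card + (leaves (march w e b)).card :=
        Nat.add_le_add (main b' hb') (main b hb)
      _ = ∑ u ∈ {march w e b', march w e b}, (leaves u).card :=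
        (Finset.sum_pair (f := fun u => (leaves u).card) hne').symm
      _ ≤ _ := Finset.sum_le_sum_of_subset (by
        intro u hu
        rcases Finset.mem_insert.1 hu with rfl | hu
        · exact hch b' hb'
        · rw [Finset.mem_singleton.1 hu]; exact hch b hb)

end Invariant

/-! ### Mean number of blocks and convexity. -/

section Average

theorem exists_perm_apply_eq {α : Type*} [DecidableEq α] {i j k a b c : α} (hij : i ≠ j)
    (hik : i ≠ k) (hjk : j ≠ k) (hab : a ≠ b) (hac : a ≠ c) (hbc : b ≠ c) :
    ∃ σ : Perm α, σ i = a ∧ σ j = b ∧ σ k = c := by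
  obtain ⟨τ, hτi, hτj⟩ : ∃ τ : Perm α, τ i = a ∧ τ j = b := by
    refine ⟨swap (swap i a j) b * swap i a, ?_, ?_⟩
    · have : a ≠ swap i a j := fun h => hij (by
        rw [← swap_apply_left i a] at h
        exact (swap i a).injective (by simpa using h))
      simp [swap_apply_of_ne_of_ne this hab]
    · simp
  refine ⟨swap (τ k) c * τ, ?_, ?_, ?_⟩
  · rw [Perm.mul_apply, swap_apply_of_ne_of_ne (τ.injective.ne hik) (hτi ▸ hac), hτi]
  · rw [Perm.mul_apply, swap_apply_of_ne_of_ne (τ.injective.ne hjk) (hτj ▸ hbc), hτj]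
  · simp

/-- A lower bound for the number of permutations that send three given points into three given
pairwise disjoint sets. -/
theorem factorial_mul_card_le {n : ℕ} {B₀ B₁ B₂ : Finset (Fin n)} (h01 : Disjoint B₀ B₁)
    (h02 : Disjoint B₀ B₂) (h12 : Disjoint B₁ B₂) {i j k : Fin n} (hij : i ≠ j) (hik : i ≠ k)
    (hjk : j ≠ k) :
    n.factorial * (B₀.card * (B₁.card * B₂.card)) ≤
      (n * (n * n)) * (Finset.univ.filter fun w : Perm (Fin n) =>
        w i ∈ B₀ ∧ w j ∈ B₁ ∧ w k ∈ B₂).card := by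
  classical
  -- Double counting of permutations against triples of positions: right multiplication makes all
  -- triples of distinct positions equivalent, and the other triples contribute nothing because the
  -- sets are disjoint.
  let r : Perm (Fin n) → Fin n × Fin n × Fin n → Prop :=
    fun w p => w p.1 ∈ B₀ ∧ w p.2.1 ∈ B₁ ∧ w p.2.2 ∈ B₂
  have hrow : ∀ w ∈ (Finset.univ : Finset (Perm (Fin n))), B₀.card * (B₁.card * B₂.card) ≤
      (Finset.univ.bipartiteAbove r w).card := by
    intro w _
    rw [← Finset.card_product, ← Finset.card_product]
    refine Finset.card_le_card_of_injOn
      (fun p => (w.symm p.1, w.symm p.2.1, w.symm p.2.2)) ?_ ?_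
    · intro p hp
      simpa [Finset.bipartiteAbove, r] using hp
    · rintro ⟨p, p', p''⟩ - ⟨q, q', q''⟩ - h
      simpa using h
  have hcol : ∀ p ∈ (Finset.univ : Finset (Fin n × Fin n × Fin n)),
      (Finset.univ.bipartiteBelow r p).card ≤ (Finset.univ.filter fun w : Perm (Fin n) =>
        w i ∈ B₀ ∧ w j ∈ B₁ ∧ w k ∈ B₂).card := by
    rintro ⟨a, b, c⟩ _
    by_cases hd : a ≠ b ∧ a ≠ c ∧ b ≠ c
    · obtain ⟨σ, rfl, rfl, rfl⟩ := exists_perm_apply_eq hij hik hjk hd.1 hd.2.1 hd.2.2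
      refine Finset.card_le_card_of_injOn (fun w => w * σ) ?_ fun w _ w' _ h => mul_right_cancel h
      intro w hw
      simpa [Finset.bipartiteBelow, r] using hw
    · have : Finset.univ.bipartiteBelow r (a, b, c) = ∅ := by
        refine Finset.filter_eq_empty_iff.2 fun w _ hw => hd ⟨?_, ?_, ?_⟩ <;> rintro rfl
        · exact Finset.disjoint_left.1 h01 hw.1 hw.2.1
        · exact Finset.disjoint_left.1 h02 hw.1 hw.2.2
        · exact Finset.disjoint_left.1 h12 hw.2.1 hw.2.2
      simp [this]
  have h := Finset.sum_card_bipartiteAbove_eq_sum_card_bipartiteBelow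
    (s := Finset.univ) (t := Finset.univ) r
  have h1 := Finset.card_nsmul_le_sum _ _ _ hrow
  have h2 := Finset.sum_le_card_nsmul _ _ _ hcol
  rw [h] at h1
  simpa [Fintype.card_perm] using h1.trans h2

theorem card_filter_val_mem_Ico {n a b : ℕ} (hb : b ≤ n) :
    (Finset.univ.filter fun v : Fin n => a ≤ v.val ∧ v.val < b).card = b - a := by
  rw [← Finset.card_map Fin.valEmbedding, ← Nat.card_Ico]
  congr 1
  ext x
  simp only [Finset.mem_map, Finset.mem_filter, Finset.mem_univ, true_and,
    Fin.valEmbedding_apply, Finset.mem_Ico]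
  exact ⟨fun ⟨v, hv, hvx⟩ => hvx ▸ hv, fun hx => ⟨⟨x, hx.2.trans_le hb⟩, hx, rfl⟩⟩

open Classical in
/-- The indices below `m` of the blocks of `w`. -/
noncomputable def blocks {n : ℕ} (m l h : ℕ) (w : Perm (Fin n)) : Finset ℕ :=
  (Finset.range m).filter fun t => IsBlock w l h t

theorem card_blocks_le {n : ℕ} (m l h : ℕ) (w : Perm (Fin n)) : (blocks m l h w).card ≤ m := by
  classical
  exact (Finset.card_filter_le _ _).trans (Finset.card_range m).le

/-- All blocks lie in the first `3 * m` rows, which can use up at most `3 * m` values of the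
interval. -/
theorem le_card_supply_blocks {n : ℕ} {m l h : ℕ} (hm : 3 * m ≤ n) (hh : h ≤ n)
    (w : Perm (Fin n)) : h - l - 3 * m ≤ (supply w l h (blocks m l h w)).card := by
  classical
  let R : Finset (Fin n) := Finset.univ.filter fun s => 0 ≤ s.val ∧ s.val < 3 * m
  let V : Finset (Fin n) := Finset.univ.filter fun v => l ≤ v.val ∧ v.val < h
  have hR : (R.image w).card ≤ 3 * m :=
    Finset.card_image_le.trans (card_filter_val_mem_Ico hm).le
  have hV : V.card = h - l := card_filter_val_mem_Ico hh
  have hsub : V \ R.image w ⊆ supply w l h (blocks m l h w) := by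
    intro v hv
    simp only [V, R, Finset.mem_sdiff, Finset.mem_filter, Finset.mem_univ, true_and,
      Finset.mem_image, not_exists, not_and] at hv
    refine mem_supply.2 ⟨hv.1.1, hv.1.2, fun t ht => ?_⟩
    have ht' : t < m := Finset.mem_range.1 (Finset.mem_filter.1 ht).1
    by_contra hc
    exact hv.2 (w.symm v) ⟨Nat.zero_le _, by omega⟩ (apply_symm_apply w v)
  have h1 := Finset.le_card_sdiff (R.image w) V
  have h2 := Finset.card_le_card hsub
  omega

theorem two_pow_card_blocks_le_card_leaves {n m : ℕ} (hm : 10 * m ≤ n) (w : Perm (Fin n)) :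
    2 ^ ((blocks m (2 * m) (n - m) w).card / 2) ≤ (leaves w).card := by
  have h1 := card_blocks_le m (2 * m) (n - m) w
  have h2 := le_card_supply_blocks (m := m) (l := 2 * m) (h := n - m) (by omega) (by omega) w
  refine two_pow_le_card_leaves (l := 2 * m) (h := n - m) (by omega) w _
    (blocks m (2 * m) (n - m) w) (fun t ht => ?_) (by omega) (by omega)
  classical
  exact (Finset.mem_filter.1 ht).2

/-- For each `t`, a block arises if the "1", "2" and "4" fall into `[0, m)`, `[m, 2m)` and `[n - m,
n)`, which has probability at least `(m / n) ^ 3`. -/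
theorem mul_factorial_le_sum_card_blocks {n m : ℕ} (hm : 10 * m ≤ n) :
    m * (n.factorial * (m * (m * m))) ≤
      (n * (n * n)) * ∑ w : Perm (Fin n), (blocks m (2 * m) (n - m) w).card := by
  classical
  have hswap : ∑ w : Perm (Fin n), (blocks m (2 * m) (n - m) w).card =
      ∑ t ∈ Finset.range m,
        (Finset.univ.filter fun w : Perm (Fin n) => IsBlock w (2 * m) (n - m) t).card :=
    (Finset.sum_card_bipartiteAbove_eq_sum_card_bipartiteBelow
      (s := (Finset.univ : Finset (Perm (Fin n)))) (t := Finset.range m)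
      fun w t => IsBlock w (2 * m) (n - m) t)
  rw [hswap, Finset.mul_sum]
  calc m * (n.factorial * (m * (m * m)))
      = ∑ t ∈ Finset.range m, n.factorial * (m * (m * m)) := by simp
    _ ≤ _ := Finset.sum_le_sum fun t ht => ?_
  have ht' := Finset.mem_range.1 ht
  let B : ℕ → ℕ → Finset (Fin n) :=
    fun a b => Finset.univ.filter fun v => a ≤ v.val ∧ v.val < b
  have hdisj : ∀ a b a' b', b ≤ a' → Disjoint (B a b) (B a' b') := by
    intro a b a' b' hba
    rw [Finset.disjoint_left]
    intro v hv hv'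
    simp only [B, Finset.mem_filter, Finset.mem_univ, true_and] at hv hv'
    omega
  let i : Fin n := ⟨3 * t, by omega⟩
  let j : Fin n := ⟨3 * t + 1, by omega⟩
  let k : Fin n := ⟨3 * t + 2, by omega⟩
  have hij : j ≠ i := by simp [i, j, Fin.ext_iff]
  have hik : j ≠ k := by simp [j, k, Fin.ext_iff]
  have hjk : i ≠ k := by simp [i, k, Fin.ext_iff]
  have hmain := factorial_mul_card_le (hdisj 0 m m (2 * m) le_rfl)
    (hdisj 0 m (n - m) n (by omega)) (hdisj m (2 * m) (n - m) n (by omega)) hij hik hjk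
  have h0 : (B 0 m).card = m := (card_filter_val_mem_Ico (by omega)).trans (by omega)
  have h1 : (B m (2 * m)).card = m := (card_filter_val_mem_Ico (by omega)).trans (by omega)
  have h2 : (B (n - m) n).card = m := (card_filter_val_mem_Ico le_rfl).trans (by omega)
  rw [h0, h1, h2] at hmain
  refine hmain.trans (Nat.mul_le_mul_left _ (Finset.card_le_card fun w hw => ?_))
  simp only [B, Finset.mem_filter, Finset.mem_univ, true_and] at hw ⊢
  exact ⟨i, j, k, rfl, rfl, rfl, Fin.lt_def.2 (by omega), by omega, by omega⟩

/-- The inequality `exp (1 / 2) ≤ 2` changes the base, and the factor 2 absorbs the rounding in `a /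
2`. -/
theorem exp_div_four_le_two_pow (a : ℕ) : Real.exp (a / 4) ≤ 2 * 2 ^ (a / 2) := by
  have h2 : Real.exp (1 / 2) ≤ 2 := by
    have h : Real.exp (1 / 2) * Real.exp (1 / 2) = Real.exp 1 := by
      rw [← Real.exp_add]; norm_num
    nlinarith [Real.exp_one_lt_d9, Real.exp_pos (1 / 2)]
  have ha : (a : ℝ) ≤ 2 * (a / 2 : ℕ) + 1 := by
    have : a ≤ 2 * (a / 2) + 1 := by omega
    exact_mod_cast this
  calc Real.exp (a / 4) ≤ Real.exp ((a / 2 + 1 : ℕ) * (1 / 2)) :=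
        Real.exp_le_exp.2 (by push_cast; linarith)
    _ = Real.exp (1 / 2) ^ (a / 2 + 1) := Real.exp_nat_mul _ _
    _ ≤ 2 ^ (a / 2 + 1) := by gcongr
    _ = 2 * 2 ^ (a / 2) := by ring

/-- Jensen's inequality for the exponential function, with a lower bound for the mean. -/
theorem exp_le_expectation_exp {n : ℕ} {X : Perm (Fin n) → ℝ} {μ : ℝ}
    (h : μ * n.factorial ≤ ∑ w, X w) : Real.exp μ ≤ expectation n fun w => Real.exp (X w) := by
  have hpos : (0 : ℝ) < n.factorial := by exact_mod_cast n.factorial_pos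
  rw [expectation, Finset.expect_eq_sum_div_card, Finset.card_univ, Fintype.card_perm,
    Fintype.card_fin, le_div_iff₀ hpos]
  -- The tangent line of the exponential at `μ`.
  have key : ∀ w, Real.exp μ * (1 + (X w - μ)) ≤ Real.exp (X w) := by
    intro w
    calc Real.exp μ * (1 + (X w - μ)) ≤ Real.exp μ * Real.exp (X w - μ) :=
          mul_le_mul_of_nonneg_left (by linarith [Real.add_one_le_exp (X w - μ)])
            (Real.exp_pos _).le
      _ = Real.exp (X w) := by rw [← Real.exp_add]; congr 1; ring
  refine le_trans ?_ (Finset.sum_le_sum fun w _ => key w)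
  rw [← Finset.mul_sum]
  refine mul_le_mul_of_nonneg_left ?_ (Real.exp_pos _).le
  simp only [Finset.sum_add_distrib, Finset.sum_sub_distrib, Finset.sum_const, Finset.card_univ,
    Fintype.card_perm, Fintype.card_fin, nsmul_eq_mul]
  linarith

theorem expectation_mono {n : ℕ} {X Y : Perm (Fin n) → ℝ} (h : ∀ w, X w ≤ Y w) :
    expectation n X ≤ expectation n Y :=
  Finset.expect_le_expect fun w _ => h w

theorem le_expectation_card_leaves {n : ℕ} (hn : 20 ≤ n) :
    1 / 2 * Real.exp (1 / 202500) ^ n ≤ expectation n fun w => ((leaves w).card : ℝ) := by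
  -- The upper bound `15 * m` needs `20 ≤ n`: it fails at 19.
  obtain ⟨m, hm1, hm2⟩ : ∃ m : ℕ, 10 * m ≤ n ∧ n ≤ 15 * m := ⟨n / 10, by omega, by omega⟩
  have hsum := mul_factorial_le_sum_card_blocks hm1
  have hcube : n * (n * n) ≤ 3375 * (m * (m * m)) := by
    calc n * (n * n) ≤ 15 * m * (15 * m * (15 * m)) := by gcongr
      _ = 3375 * (m * (m * m)) := by ring
  have hmpos : 0 < m * (m * m) := by
    have : 0 < m := by omega
    positivity
  have hsum' : m * n.factorial ≤
      3375 * ∑ w : Perm (Fin n), (blocks m (2 * m) (n - m) w).card := by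
    refine Nat.le_of_mul_le_mul_left ?_ hmpos
    calc m * (m * m) * (m * n.factorial) = m * (n.factorial * (m * (m * m))) := by ring
      _ ≤ _ := hsum
      _ ≤ 3375 * (m * (m * m)) * ∑ w : Perm (Fin n), (blocks m (2 * m) (n - m) w).card := by
        gcongr
      _ = _ := by ring
  -- Here `202500 = 3375 * 15 * 4`: the cube bound, `n ≤ 15 * m`, and the quarter in the exponent.
  have hmean : (1 / 202500 * n : ℝ) * n.factorial ≤
      ∑ w : Perm (Fin n), ((blocks m (2 * m) (n - m) w).card : ℝ) / 4 := by
    rw [← Finset.sum_div]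
    have h1 : (m * n.factorial : ℝ) ≤
        3375 * ∑ w : Perm (Fin n), ((blocks m (2 * m) (n - m) w).card : ℝ) := by
      exact_mod_cast hsum'
    have h2 : (n * n.factorial : ℝ) ≤ 15 * m * n.factorial := by
      gcongr
      exact_mod_cast hm2
    linarith
  have hexp := exp_le_expectation_exp hmean
  have hpow : Real.exp (1 / 202500) ^ n = Real.exp (1 / 202500 * n) := by
    rw [← Real.exp_nat_mul, mul_comm]
  have hle : (expectation n fun w => Real.exp ((blocks m (2 * m) (n - m) w).card / 4)) ≤
      expectation n fun w => 2 * ((leaves w).card : ℝ) := by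
    refine expectation_mono fun w => (exp_div_four_le_two_pow _).trans ?_
    have := two_pow_card_blocks_le_card_leaves hm1 w
    have h : ((2 : ℝ) ^ ((blocks m (2 * m) (n - m) w).card / 2)) ≤ (leaves w).card := by
      exact_mod_cast this
    linarith
  have htwo : (expectation n fun w => 2 * ((leaves w).card : ℝ)) =
      2 * expectation n fun w => ((leaves w).card : ℝ) :=
    (Finset.mul_expect _ _ _).symm
  rw [hpow]
  linarith

end Average

end LSTransition

theorem theorem1p2 :
    ∃ c : ℝ, 1 < c ∧ ∃ C : ℝ, 0 < C ∧ ∀ᶠ n : ℕ in Filter.atTop,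
      C * c ^ n ≤ LSTransition.expectation n (fun w => ((LSTransition.leaves w).card : ℝ)) ∧
      ∀ cost : Equiv.Perm (Fin n) → ℕ, (∀ v, 1 ≤ cost v) →
        C * c ^ n ≤ LSTransition.expectation n (fun w => (LSTransition.runningTime cost w : ℝ)) := by
  refine ⟨Real.exp (1 / 202500), Real.one_lt_exp_iff.2 (by norm_num), 1 / 2, by norm_num,
    Filter.eventually_atTop.2 ⟨20, fun n hn => ?_⟩⟩
  have h := LSTransition.le_expectation_card_leaves hn
  refine ⟨h, fun cost hcost => h.trans (LSTransition.expectation_mono fun w => ?_)⟩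
  exact_mod_cast LSTransition.card_leaves_le_runningTime hcost w
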